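/- **Setting.** Let $n\ge 3$ and let $0<X_A\le X_B$. A generalized Colonel Blotto (GCB) game with $n$ battlefields and budgets $X_A,X_B$ is given by battlefield values $w^A_i,w^B_i>0$ ($i\in[n]$) and a tie-breaking parameter $\alpha\in[0,1]$. A pure strategy of player $P\in\{A,B\}$ is a vector $x^P\in\mathbb R_{\ge0}^n$ with $\sum_i x^P_i\le X_P$; a mixed strategy is a probability distribution on pure strategies. The payoffs are $\Pi_A(x^A,x^B)=\sum_i w^A_i\,\beta_A(x^A_i,x^B_i)$ and $\Pi_B(x^A,x^B)=\sum_i w^B_i\,\beta_B(x^A_i,x^B_i)$, where $\beta_A(x,y)$ is $1,\alpha,0$ and $\beta_B(x,y)$ is $0,1-\alpha,1$ according to whether $x>y$, $x=y$, $x<y$; for mixed strategies, drawn independently, $\Pi_A,\Pi_B$ denote the expected payoffs. A profile $(s^*,t^*)$ of mixed strategies is a $\delta$-equilibrium if $\Pi_A(s,t^*)\le\Pi_A(s^*,t^*)+\delta$ and $\Pi_B(s^*,t)\le\Pi_B(s^*,t^*)+\delta$ for all mixed strategies $s$ of $A$ and $t$ of $B$. Put $W_P=\sum_i w^P_i$,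 $v^P_i=w^P_i/W_P$ and $W=\max\{W_A,W_B\}$. For $\gamma>0$ let $\Omega_A(\gamma)=\{i: v^A_i/v^B_i>\gamma\}$, and let $\mathcal S_n$ be the set of all $\gamma>0$ with $$\frac{X_B\gamma}{X_A}=\frac{\gamma^2\sum_{i\in\Omega_A(\gamma)}\frac{(v^B_i)^2}{v^A_i}+\sum_{i\notin\Omega_A(\gamma)}v^A_i}{\sum_{i\in\Omega_A(\gamma)}v^B_i+\frac1{\gamma^2}\sum_{i\notin\Omega_A(\gamma)}\frac{(v^A_i)^2}{v^B_i}}.$$ For $\gamma^*\in\mathcal S_n$ put $$\lambda_A^*=\frac{(\gamma^*)^2}{2X_B}\sum_{i\in\Omega_A(\gamma^*)}\frac{(v^B_i)^2}{v^A_i}+\frac1{2X_B}\sum_{i\notin\Omega_A(\gamma^*)}v^A_i,\qquad \lambda_B^*=\frac1{2X_A}\sum_{i\in\Omega_A(\gamma^*)}v^B_i+\frac1{2(\gamma^*)^2X_A}\sum_{i\notin\Omega_A(\gamma^*)}\frac{(v^A_i)^2}{v^B_i},$$ and $p_i=v^A_i/\lambda^*_A$, $q_i=v^B_i/\lambda^*_B$.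 If $i\in\Omega_A(\gamma^*)$, let $A^*_i$ be uniform on $[0,q_i]$ and let $B^*_i$ be $0$ with probability $(p_i-q_i)/p_i$ and otherwise uniform on $[0,q_i]$. If $i\notin\Omega_A(\gamma^*)$, let $A^*_i$ be $0$ with probability $(q_i-p_i)/q_i$ and otherwise uniform on $[0,p_i]$, and let $B^*_i$ be uniform on $[0,p_i]$. The strategy $\mathrm{IU}^{\gamma^*}_A$ draws $a_i\sim A^*_i$ independently over $i\in[n]$ and plays $x^A_i=\frac{a_i}{\sum_j a_j}X_A$ for all $i$ (and $x^A=0$ if $\sum_j a_j=0$); $\mathrm{IU}^{\gamma^*}_B$ is defined in the same way from the $B^*_i$ and $X_B$. The $\mathrm{IU}^{\gamma^*}$ strategy profile is $(\mathrm{IU}^{\gamma^*}_A,\mathrm{IU}^{\gamma^*}_B)$. **Claim.** Let $0<X_A\le X_B$ and $\underline w,\overline w>0$. There is a sequence of positive numbers $\varepsilon_n$, depending only on $n,X_A,X_B,\underline w,\overline w$, with $\varepsilon_n=\tilde{\mathcal O}(n^{-1/2})$, that is, $\varepsilon_n=\mathcal O\big(n^{-1/2}(\ln n)^k\big)$ as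 $n\to\infty$ for some $k\in\mathbb N$, such that the following holds. For every $n\ge3$, in every GCB game with $n$ battlefields and budgets $X_A,X_B$ that satisfies assumption (A0), i.e. $\underline w\le w^P_i\le\overline w$ for all $i\in[n]$ and $P\in\{A,B\}$, and for every $\gamma^*\in\mathcal S_n$, the $\mathrm{IU}^{\gamma^*}$ strategy profile is an $\varepsilon_nW$-equilibrium. -/

import Mathlib

open MeasureTheory Filter

noncomputable section

/-- `f = Õ(g)`: there is a power `k` of the logarithm such that `f(n) = O(g(n) (log n)^k)`
as `n → ∞`. -/
def IsSoftO (f g : ℕ → ℝ) : Prop :=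
  ∃ k : ℕ, f =O[atTop] fun n : ℕ => g n * Real.log (n : ℝ) ^ k

/-- Amount won by player A, per unit of value, when A allocates `x` and B allocates `y`
to a battlefield; ties are split according to `α`. -/
def blottoA (α x y : ℝ) : ℝ := if y < x then 1 else if x = y then α else 0

/-- Amount won by player B, per unit of value, when A allocates `x` and B allocates `y`. -/
def blottoB (α x y : ℝ) : ℝ := if x < y then 1 else if x = y then 1 - α else 0

/-- A Generalized Colonel Blotto game with `n` battlefields and budgets `X_A ≤ X_B`:
its parameters are the tie-breaking parameter `α` and the values `wA i`, `wB i` of the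
battlefields for the two players. -/
structure GCBGame (n : ℕ) (X_A X_B : ℝ) where
  three_le : 3 ≤ n
  budgetA_pos : 0 < X_A
  budget_le : X_A ≤ X_B
  α : ℝ
  α_nonneg : 0 ≤ α
  α_le_one : α ≤ 1
  wA : Fin n → ℝ
  wB : Fin n → ℝ
  wA_pos : ∀ i, 0 < wA i
  wB_pos : ∀ i, 0 < wB i

/-- The pure strategies of a player with budget `X`. -/
def pureStrategies (n : ℕ) (X : ℝ) : Set (Fin n → ℝ) :=
  {x | (∀ i, 0 ≤ x i) ∧ ∑ i, x i ≤ X}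

/-- A mixed strategy of a player with budget `X`: a joint distribution of the allocations
under which the drawn allocation is (almost surely) a pure strategy. -/
def IsMixedStrategy {n : ℕ} (X : ℝ) (s : Measure (Fin n → ℝ)) : Prop :=
  IsProbabilityMeasure s ∧ ∀ᵐ x ∂s, x ∈ pureStrategies n X

/-- The law of a number that is `0` with probability `p` and is uniform on `[0, c]` with
probability `1 - p`. For `0 ≤ p ≤ 1` and `0 < c` its distribution function on `[0, c]` is
`x ↦ p + (1 - p) x / c`. -/
def atomUniform (p c : ℝ) : Measure ℝ :=
  ENNReal.ofReal p • Measure.dirac 0 +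
    ENNReal.ofReal (1 - p) • ProbabilityTheory.cond volume (Set.Icc 0 c)

/-- Rescale the vector `a` to total amount `X`; the allocation is `0` if the entries of `a`
sum to `0`. -/
def rescale {n : ℕ} (X : ℝ) (a : Fin n → ℝ) : Fin n → ℝ :=
  fun i => if ∑ j, a j = 0 then 0 else a i / (∑ j, a j) * X

namespace GCBGame

variable {n : ℕ} {X_A X_B : ℝ} (G : GCBGame n X_A X_B)

/-- Payoff of player A at a pure strategy profile. -/
def purePayoffA (x y : Fin n → ℝ) : ℝ := ∑ i, G.wA i * blottoA G.α (x i) (y i)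

/-- Payoff of player B at a pure strategy profile. -/
def purePayoffB (x y : Fin n → ℝ) : ℝ := ∑ i, G.wB i * blottoB G.α (x i) (y i)

/-- Expected payoff of player A when the players draw independently from `s` and `t`. -/
def payoffA (s t : Measure (Fin n → ℝ)) : ℝ := ∫ z, G.purePayoffA z.1 z.2 ∂(s.prod t)

/-- Expected payoff of player B when the players draw independently from `s` and `t`. -/
def payoffB (s t : Measure (Fin n → ℝ)) : ℝ := ∫ z, G.purePayoffB z.1 z.2 ∂(s.prod t)

/-- The mixed strategy profile `(s, t)` is a `δ`-equilibrium of the game. -/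
def IsApproxEquilibrium (δ : ℝ) (s t : Measure (Fin n → ℝ)) : Prop :=
  IsMixedStrategy X_A s ∧ IsMixedStrategy X_B t ∧
    (∀ s', IsMixedStrategy X_A s' → G.payoffA s' t ≤ G.payoffA s t + δ) ∧
    (∀ t', IsMixedStrategy X_B t' → G.payoffB s t' ≤ G.payoffB s t + δ)

/-- Total values of the battlefields. -/
def totalA : ℝ := ∑ i, G.wA i

def totalB : ℝ := ∑ i, G.wB i

/-- Normalized values of the battlefields. -/
def vA (i : Fin n) : ℝ := G.wA i / G.totalA

def vB (i : Fin n) : ℝ := G.wB i / G.totalB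

/-- All battlefield values of both players lie between `w_lo` and `w_hi`. -/
def ValuesBounded (w_lo w_hi : ℝ) : Prop :=
  ∀ i, w_lo ≤ G.wA i ∧ G.wA i ≤ w_hi ∧ w_lo ≤ G.wB i ∧ G.wB i ≤ w_hi

/-- The set `Ω_A(γ)` of battlefields with `v^A_i / v^B_i > γ`. -/
def OmegaA (γ : ℝ) : Finset (Fin n) := {i | γ < G.vA i / G.vB i}

/-- The set `S_n` of positive solutions `γ` of the equation that determines the
uniform-type distributions. -/
def solutions : Set ℝ :=
  {γ | 0 < γ ∧
    X_B * γ / X_A =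
      (γ ^ 2 * ∑ i ∈ G.OmegaA γ, G.vB i ^ 2 / G.vA i + ∑ i ∈ (G.OmegaA γ)ᶜ, G.vA i) /
        (∑ i ∈ G.OmegaA γ, G.vB i + 1 / γ ^ 2 * ∑ i ∈ (G.OmegaA γ)ᶜ, G.vA i ^ 2 / G.vB i)}

def lambdaA (γ : ℝ) : ℝ :=
  γ ^ 2 / (2 * X_B) * ∑ i ∈ G.OmegaA γ, G.vB i ^ 2 / G.vA i +
    1 / (2 * X_B) * ∑ i ∈ (G.OmegaA γ)ᶜ, G.vA i

def lambdaB (γ : ℝ) : ℝ :=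
  1 / (2 * X_A) * ∑ i ∈ G.OmegaA γ, G.vB i +
    1 / (2 * γ ^ 2 * X_A) * ∑ i ∈ (G.OmegaA γ)ᶜ, G.vA i ^ 2 / G.vB i

/-- The distribution of `A*_i`: uniform on `[0, v^B_i / λ_B]` if `i ∈ Ω_A(γ)`; otherwise an atom
at `0` and the remaining mass uniform on `[0, v^A_i / λ_A]`. -/
def distA (γ : ℝ) (i : Fin n) : Measure ℝ :=
  let a := G.vA i / G.lambdaA γ
  let b := G.vB i / G.lambdaB γ
  if i ∈ G.OmegaA γ then atomUniform 0 b else atomUniform ((b - a) / b) a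

/-- The distribution of `B*_i`: an atom at `0` and the remaining mass uniform on
`[0, v^B_i / λ_B]` if `i ∈ Ω_A(γ)`; otherwise uniform on `[0, v^A_i / λ_A]`. -/
def distB (γ : ℝ) (i : Fin n) : Measure ℝ :=
  let a := G.vA i / G.lambdaA γ
  let b := G.vB i / G.lambdaB γ
  if i ∈ G.OmegaA γ then atomUniform ((a - b) / a) b else atomUniform 0 a

/-- The independently uniform strategy of player A: draw the `a_i ∼ A*_i` independently and
rescale them to the budget. -/
def iuA (γ : ℝ) : Measure (Fin n → ℝ) := (Measure.pi (G.distA γ)).map (rescale X_A)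

/-- The independently uniform strategy of player B. -/
def iuB (γ : ℝ) : Measure (Fin n → ℝ) := (Measure.pi (G.distB γ)).map (rescale X_B)

end GCBGame

end

/-! Before rescaling, the independent bids form an equilibrium of the relaxed game in which budgets
bind only in expectation. Write `c i` for the common top of the two supports on battlefield `i`, and
`a i`, `b i` for the atoms at `0`. Against `B*` a bid `x` on battlefield `i` wins with probability
at most `b i + (1 - b i) * x / c i`, so it earns at most `w i * b i + L * x`, where the slope `L` is
the same on every battlefield. Hence no strategy within budget `X` earns more than `∑ w b + L X`.
The bids `A*` stay in `[0, c i]`, where the bound is exact, and their expected total is `X`, so they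
attain it. `IsUniformProfile` records what this argument uses and serves both players with roles
exchanged.

Rescaling is harmless because the totals concentrate. If all caps are at most `K / n`, Hoeffding's
inequality puts the totals within a relative error `η` of order `√(log n / n)` of the budgets,
except with probability `δ = O(1 / n)`. Off that event bids change only by factors between `1 / (1 +
η)` and `1 / (1 - η)`. Comparing the upper bound `integral_le` with the lower bound `le_integral`
leaves a possible gain of `(2η + 3δ) ∑ w`.

The bound on the caps must be uniform in the game and in `γ`. It follows from a lower bound on
`λ_A`, which rests on the lower bound `ratio_pow_le_of_mem_solutions` for `γ`. -/

/-! ### Uniform laws with an atom at zero -/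

lemma volume_Icc_zero_ne_zero {c : ℝ} (hc : 0 < c) : volume (Set.Icc 0 c) ≠ 0 := by
  simpa using hc

lemma isProbabilityMeasure_atomUniform {p c : ℝ} (hp : 0 ≤ p) (hp1 : p ≤ 1) (hc : 0 < c) :
    IsProbabilityMeasure (atomUniform p c) := by
  have := ProbabilityTheory.cond_isProbabilityMeasure_of_finite (volume_Icc_zero_ne_zero hc)
    measure_Icc_lt_top.ne
  constructor
  simp only [atomUniform, Measure.coe_add, Measure.coe_smul, Pi.add_apply, Pi.smul_apply,
    measure_univ, smul_eq_mul, mul_one]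
  rw [← ENNReal.ofReal_add hp (by linarith)]
  simp

lemma atomUniform_ae_mem_Icc (p : ℝ) {c : ℝ} (hc : 0 < c) :
    ∀ᵐ x ∂atomUniform p c, x ∈ Set.Icc 0 c := by
  rw [ae_iff, atomUniform]
  have h0 : (0 : ℝ) ∈ Set.Icc 0 c := ⟨le_rfl, hc.le⟩
  have h1 : ProbabilityTheory.cond volume (Set.Icc 0 c) (Set.Icc 0 c)ᶜ = 0 := by
    rw [ProbabilityTheory.cond_apply measurableSet_Icc]
    simp
  have h2 : {a : ℝ | a ∉ Set.Icc 0 c} = (Set.Icc 0 c)ᶜ := rfl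
  rw [h2]
  simp [h1, Measure.dirac_apply' _ measurableSet_Icc.compl, h0]

lemma integral_atomUniform {p c : ℝ} (hp : 0 ≤ p) (hp1 : p ≤ 1) (hc : 0 < c) {f : ℝ → ℝ}
    (hf : IntervalIntegrable f volume 0 c) :
    ∫ x, f x ∂atomUniform p c = p * f 0 + (1 - p) * (c⁻¹ * ∫ x in 0..c, f x) := by
  have hf' : Integrable f (volume.restrict (Set.Icc 0 c)) := by
    refine (integrableOn_Icc_iff_integrableOn_Ioc (by simp)).2 ?_
    exact (intervalIntegrable_iff_integrableOn_Ioc_of_le hc.le).1 hf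
  have hc' : (volume (Set.Icc 0 c))⁻¹ ≠ ⊤ := by simpa using hc
  rw [atomUniform, integral_add_measure, integral_smul_measure, integral_smul_measure,
    integral_dirac, ProbabilityTheory.cond, integral_smul_measure,
    ENNReal.toReal_ofReal hp, ENNReal.toReal_ofReal (by linarith),
    integral_Icc_eq_integral_Ioc, intervalIntegral.integral_of_le hc.le]
  · simp [ENNReal.toReal_ofReal hc.le]
  · exact (integrable_dirac (by simp)).smul_measure ENNReal.ofReal_ne_top
  · exact (hf'.smul_measure hc').smul_measure ENNReal.ofReal_ne_top

lemma integral_id_atomUniform {p c : ℝ} (hp : 0 ≤ p) (hp1 : p ≤ 1) (hc : 0 < c) :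
    ∫ x, x ∂atomUniform p c = (1 - p) * c / 2 := by
  rw [integral_atomUniform hp hp1 hc intervalIntegral.intervalIntegrable_id, integral_id]
  field_simp
  ring

lemma atomUniform_real_apply {p c : ℝ} (hp : 0 ≤ p) (hp1 : p ≤ 1) (hc : 0 < c) {s : Set ℝ}
    (hs : MeasurableSet s) :
    (atomUniform p c).real s =
      p * s.indicator 1 0 + (1 - p) * (volume.real (Set.Icc 0 c ∩ s) / c) := by
  have := ProbabilityTheory.cond_isProbabilityMeasure_of_finite (volume_Icc_zero_ne_zero hc)
    measure_Icc_lt_top.ne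
  have := Measure.smul_finite (Measure.dirac (0 : ℝ)) (ENNReal.ofReal_ne_top (r := p))
  have := Measure.smul_finite (ProbabilityTheory.cond volume (Set.Icc 0 c))
    (ENNReal.ofReal_ne_top (r := 1 - p))
  rw [atomUniform, measureReal_add_apply]
  · simp only [measureReal_ennreal_smul_apply, ENNReal.toReal_ofReal hp,
      ENNReal.toReal_ofReal (sub_nonneg.2 hp1)]
    congr 2
    · rw [measureReal_def, Measure.dirac_apply' _ hs]
      by_cases h : (0 : ℝ) ∈ s <;> simp [h]
    · rw [measureReal_def, ProbabilityTheory.cond_apply measurableSet_Icc]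
      simp [ENNReal.toReal_ofReal hc.le, measureReal_def, div_eq_inv_mul]

lemma atomUniform_real_Iic_le {p c x : ℝ} (hp : 0 ≤ p) (hp1 : p ≤ 1) (hc : 0 < c) (hx : 0 ≤ x) :
    (atomUniform p c).real (Set.Iic x) ≤ p + (1 - p) * (x / c) := by
  rw [atomUniform_real_apply hp hp1 hc measurableSet_Iic]
  have h1 : volume.real (Set.Icc 0 c ∩ Set.Iic x) ≤ x := by
    calc volume.real (Set.Icc 0 c ∩ Set.Iic x) ≤ volume.real (Set.Icc 0 x) :=
          measureReal_mono (fun y hy => ⟨hy.1.1, hy.2⟩) measure_Icc_lt_top.ne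
      _ = x := by simp [hx]
  have h2 : volume.real (Set.Icc 0 c ∩ Set.Iic x) / c ≤ x / c := by gcongr
  have h3 := mul_le_mul_of_nonneg_left h2 (sub_nonneg.2 hp1)
  simpa [hx] using h3

/-- On `[0, c]` the distribution function has slope `(1 - p) / c`, so moving from `x` to `x * (1 +
η)` costs at most `(1 - p) * (x / c) * η ≤ η`. Beyond `c` the right-hand side is already at least
`1`. -/
lemma atomUniform_real_Iic_mul_le {p c x η : ℝ} (hp : 0 ≤ p) (hp1 : p ≤ 1) (hc : 0 < c)
    (hx : 0 ≤ x) (hη : 0 ≤ η) :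
    (atomUniform p c).real (Set.Iic (x * (1 + η))) ≤ p + (1 - p) * (x / c) + η := by
  rcases le_total x c with h | h
  · refine (atomUniform_real_Iic_le hp hp1 hc (by positivity)).trans ?_
    have h1 : x / c ≤ 1 := (div_le_one hc).2 h
    have h2 : (1 - p) * (x / c) ≤ 1 :=
      mul_le_one₀ (by linarith) (by positivity) h1
    have h3 : (1 - p) * (x * (1 + η) / c) = (1 - p) * (x / c) + (1 - p) * (x / c) * η := by ring
    nlinarith
  · have := isProbabilityMeasure_atomUniform hp hp1 hc
    refine measureReal_le_one.trans ?_
    have h1 : 1 ≤ x / c := (one_le_div hc).2 h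
    nlinarith

lemma atomUniform_real_Iio {p c x : ℝ} (hp : 0 ≤ p) (hp1 : p ≤ 1) (hc : 0 < c) (hx : 0 < x)
    (hxc : x ≤ c) : (atomUniform p c).real (Set.Iio x) = p + (1 - p) * (x / c) := by
  rw [atomUniform_real_apply hp hp1 hc measurableSet_Iio]
  have h1 : Set.Icc 0 c ∩ Set.Iio x = Set.Ico 0 x := by
    ext y
    simp only [Set.mem_inter_iff, Set.mem_Icc, Set.mem_Iio, Set.mem_Ico]
    constructor
    · rintro ⟨⟨h, -⟩, h'⟩
      exact ⟨h, h'⟩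
    · rintro ⟨h, h'⟩
      exact ⟨⟨h, h'.le.trans hxc⟩, h'⟩
  rw [h1]
  simp [hx, hx.le]

/-- Lower bound for the probability that `B < τ A` for independent `A`, `B`. -/
lemma le_atomUniform_prod_real_lt {a b c τ : ℝ} (ha : 0 ≤ a) (ha1 : a ≤ 1) (hb : 0 ≤ b)
    (hb1 : b ≤ 1) (hc : 0 < c) (hτ : 0 < τ) (hτ1 : τ ≤ 1) :
    (1 - a) * (b + (1 - b) * τ / 2) ≤
      ((atomUniform a c).prod (atomUniform b c)).real {z | z.2 < τ * z.1} := by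
  have := isProbabilityMeasure_atomUniform ha ha1 hc
  have := isProbabilityMeasure_atomUniform hb hb1 hc
  have hs : MeasurableSet {z : ℝ × ℝ | z.2 < τ * z.1} :=
    measurableSet_lt measurable_snd (measurable_fst.const_mul τ)
  set g : ℝ → ℝ := fun x => (atomUniform b c).real (Set.Iio (τ * x)) with hg
  have hmono : Monotone g := fun x y hxy =>
    measureReal_mono (Set.Iio_subset_Iio (mul_le_mul_of_nonneg_left hxy hτ.le))
  have h1 : ((atomUniform a c).prod (atomUniform b c)).real {z | z.2 < τ * z.1} =
      ∫ x, g x ∂atomUniform a c := by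
    rw [measureReal_def, Measure.prod_apply hs, hg]
    simp only [measureReal_def]
    exact (integral_toReal (measurable_measure_prodMk_left hs).aemeasurable (by simp)).symm
  rw [h1, integral_atomUniform ha ha1 hc hmono.intervalIntegrable]
  -- Because `τ ≤ 1`, the point `τ * x` stays in `(0, c]`, where the distribution function is
  -- affine.
  have h2 : ∫ x in 0..c, g x = ∫ x in 0..c, (b + (1 - b) * τ / c * x) := by
    rw [intervalIntegral.integral_of_le hc.le, intervalIntegral.integral_of_le hc.le]
    refine setIntegral_congr_fun measurableSet_Ioc fun x hx => ?_
    have := mul_le_mul_of_nonneg_right hτ1 hx.1.le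
    simp only [hg]
    rw [atomUniform_real_Iio hb hb1 hc (mul_pos hτ hx.1) (by linarith [hx.2])]
    ring
  have h3 : c⁻¹ * ∫ x in 0..c, (b + (1 - b) * τ / c * x) = b + (1 - b) * τ / 2 := by
    rw [intervalIntegral.integral_add (by simp)
      ((intervalIntegral.intervalIntegrable_id).const_mul _),
      intervalIntegral.integral_const_mul, integral_id]
    simp
    field_simp
  rw [h2, h3]
  have : 0 ≤ a * g 0 := mul_nonneg ha measureReal_nonneg
  linarith

/-! ### Concentration of sums -/

/-- Two-sided Hoeffding inequality for independent variables with values in `[0, R]`. -/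
lemma pi_real_abs_sum_sub_integral_ge_le {n : ℕ} {R t : ℝ} (hR : 0 ≤ R) (ht : 0 ≤ t)
    (μ : Fin n → Measure ℝ) [∀ i, IsProbabilityMeasure (μ i)]
    (hμ : ∀ i, ∀ᵐ x ∂μ i, x ∈ Set.Icc 0 R) :
    (Measure.pi μ).real {x | t ≤ |∑ i, x i - ∑ i, ∫ y, y ∂μ i|} ≤
      2 * Real.exp (-(2 * t ^ 2 / (n * R ^ 2))) := by
  set Y : Fin n → (Fin n → ℝ) → ℝ := fun i x => x i - ∫ y, y ∂μ i with hY
  have hind : ProbabilityTheory.iIndepFun Y (Measure.pi μ) :=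
    ProbabilityTheory.iIndepFun_pi (X := fun i y => y - ∫ y, y ∂μ i)
      fun i => (measurable_id.sub_const _).aemeasurable
  have hind' : ProbabilityTheory.iIndepFun (fun i => -Y i) (Measure.pi μ) :=
    hind.comp (fun _ y => -y) fun _ => measurable_neg
  have hsub : ∀ i, ProbabilityTheory.HasSubgaussianMGF (Y i) ((‖R - 0‖₊ / 2) ^ 2)
      (Measure.pi μ) := by
    intro i
    have hmp := measurePreserving_eval μ i
    have h := ProbabilityTheory.hasSubgaussianMGF_of_mem_Icc (X := fun x : Fin n → ℝ => x i)
      (μ := Measure.pi μ) (a := 0) (b := R) (measurable_pi_apply i).aemeasurable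
      (hmp.quasiMeasurePreserving.ae (hμ i))
    have hint : ∫ x : Fin n → ℝ, x i ∂Measure.pi μ = ∫ y, y ∂μ i := by
      have h' := integral_map (μ := Measure.pi μ) (φ := Function.eval i) (f := fun y : ℝ => y)
        hmp.measurable.aemeasurable measurable_id.aestronglyMeasurable
      rw [hmp.map_eq] at h'
      exact h'.symm
    rwa [hint] at h
  have hsum : ∀ x, ∑ i, Y i x = ∑ i, x i - ∑ i, ∫ y, y ∂μ i := fun x => by
    simp [hY, Finset.sum_sub_distrib]
  have hexp : -t ^ 2 / (2 * ((∑ _i : Fin n, (‖R - 0‖₊ / 2) ^ 2 : NNReal) : ℝ)) =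
      -(2 * t ^ 2 / (n * R ^ 2)) := by
    simp only [sub_zero, Finset.sum_const, Finset.card_univ, Fintype.card_fin, nsmul_eq_mul]
    push_cast
    rw [Real.norm_of_nonneg hR, ← neg_div]
    -- In the degenerate case both exponents are divisions by zero, hence `0`.
    by_cases h : (n : ℝ) * R ^ 2 = 0
    · have : 2 * ((n : ℝ) * (R / 2) ^ 2) = 0 := by nlinarith
      rw [this, h, div_zero, div_zero]
    · have : 2 * ((n : ℝ) * (R / 2) ^ 2) = (n * R ^ 2) / 2 := by ring
      rw [this]
      field_simp
  have h1 := ProbabilityTheory.HasSubgaussianMGF.measure_sum_ge_le_of_iIndepFun hind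
    (s := Finset.univ) (fun i _ => hsub i) ht
  have h2 := ProbabilityTheory.HasSubgaussianMGF.measure_sum_ge_le_of_iIndepFun hind'
    (s := Finset.univ) (fun i _ => (hsub i).neg) ht
  rw [hexp] at h1 h2
  calc _ ≤ (Measure.pi μ).real ({x | t ≤ ∑ i, Y i x} ∪ {x | t ≤ ∑ i, (-Y i) x}) := by
        refine measureReal_mono fun x hx => ?_
        simp only [Set.mem_ofPred_eq, ← hsum] at hx
        simp only [Pi.neg_apply, Finset.sum_neg_distrib]
        exact le_abs.1 hx
    _ ≤ _ := (measureReal_union_le _ _).trans (by linarith)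

/-! ### Rescaling to the budget -/

lemma measurable_rescale {n : ℕ} (X : ℝ) : Measurable (rescale X : (Fin n → ℝ) → Fin n → ℝ) := by
  have hS : Measurable fun a : Fin n → ℝ => ∑ j, a j :=
    Finset.measurable_sum _ fun i _ => measurable_pi_apply i
  refine measurable_pi_lambda _ fun i => ?_
  exact Measurable.ite (hS (measurableSet_singleton 0)) measurable_const
    (((measurable_pi_apply i).div hS).mul_const X)

lemma rescale_mem_pureStrategies {n : ℕ} {X : ℝ} (hX : 0 ≤ X) {a : Fin n → ℝ}
    (ha : ∀ i, 0 ≤ a i) : rescale X a ∈ pureStrategies n X := by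
  have hS : 0 ≤ ∑ j, a j := Finset.sum_nonneg fun i _ => ha i
  by_cases h : ∑ j, a j = 0
  · simp [pureStrategies, rescale, h, hX]
  · refine ⟨fun i => ?_, ?_⟩
    · simp only [rescale, h, if_false]
      exact mul_nonneg (div_nonneg (ha i) hS) hX
    · simp only [rescale, h, if_false]
      rw [← Finset.sum_mul, ← Finset.sum_div, div_self h, one_mul]

lemma isMixedStrategy_map_rescale {n : ℕ} {X : ℝ} (hX : 0 ≤ X) (μ : Fin n → Measure ℝ)
    [∀ i, IsProbabilityMeasure (μ i)] (hμ : ∀ i, ∀ᵐ x ∂μ i, 0 ≤ x) :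
    IsMixedStrategy X ((Measure.pi μ).map (rescale X)) := by
  refine ⟨Measure.isProbabilityMeasure_map (measurable_rescale X).aemeasurable, ?_⟩
  have hms : MeasurableSet (pureStrategies n X) := by
    have h1 : MeasurableSet {x : Fin n → ℝ | ∑ i, x i ≤ X} :=
      measurableSet_le (Finset.measurable_sum _ fun i _ => measurable_pi_apply i) measurable_const
    have h2 : MeasurableSet {x : Fin n → ℝ | ∀ i, 0 ≤ x i} := by
      simp only [Set.ofPred_forall]
      exact MeasurableSet.iInter fun i => measurableSet_le measurable_const (measurable_pi_apply i)
    exact h2.inter h1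
  refine (ae_map_iff (measurable_rescale X).aemeasurable hms).2 ?_
  have h : ∀ᵐ a ∂Measure.pi μ, ∀ i, 0 ≤ a i :=
    ae_all_iff.2 fun i => (measurePreserving_eval μ i).quasiMeasurePreserving.ae (hμ i)
  filter_upwards [h] with a ha using rescale_mem_pureStrategies hX ha

/-- Allocations whose total differs from `X` by at least `η X`. -/
def deviantSet (n : ℕ) (X η : ℝ) : Set (Fin n → ℝ) := {a | η * X ≤ |∑ i, a i - X|}

lemma sum_mem_Ioo_of_notMem_deviantSet {n : ℕ} {X η : ℝ} {a : Fin n → ℝ}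
    (ha : a ∉ deviantSet n X η) : ∑ i, a i ∈ Set.Ioo ((1 - η) * X) ((1 + η) * X) := by
  have h : |∑ i, a i - X| < η * X := not_le.1 ha
  rw [abs_lt] at h
  constructor <;> linarith [h.1, h.2]

/-! ### Uniform profiles and winning rules -/

/-- Independent uniform-type bids of a player with budget `X` and values `w` against an opponent
with budget `Y`: on battlefield `i` the player draws from `atomUniform (a i) (c i)` and the
opponent from `atomUniform (b i) (c i)`, and the marginal value of a bid is `L` everywhere. -/
structure IsUniformProfile {n : ℕ} (X Y L : ℝ) (w a b c : Fin n → ℝ) : Prop where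
  w_nonneg : ∀ i, 0 ≤ w i
  a_nonneg : ∀ i, 0 ≤ a i
  a_le_one : ∀ i, a i ≤ 1
  b_nonneg : ∀ i, 0 ≤ b i
  b_le_one : ∀ i, b i ≤ 1
  c_pos : ∀ i, 0 < c i
  mul_eq_zero : ∀ i, a i * b i = 0
  slope_nonneg : 0 ≤ L
  slope : ∀ i, w i * (1 - b i) = L * c i
  sum_a : ∑ i, (1 - a i) * c i / 2 = X
  sum_b : ∑ i, (1 - b i) * c i / 2 = Y

/-- A rule for winning a battlefield with a bid `x` against `y`, up to the treatment of ties. -/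
structure IsWinRule (β : ℝ → ℝ → ℝ) : Prop where
  measurable : Measurable (Function.uncurry β)
  nonneg : ∀ x y, 0 ≤ β x y
  le_one : ∀ x y, β x y ≤ 1
  of_lt : ∀ x y, y < x → β x y = 1
  of_gt : ∀ x y, x < y → β x y = 0

namespace IsWinRule

variable {n : ℕ} {β : ℝ → ℝ → ℝ} (hβ : IsWinRule β)
include hβ

lemma measurable_apply (i : Fin n) :
    Measurable fun z : (Fin n → ℝ) × (Fin n → ℝ) => β (z.1 i) (z.2 i) := by
  have h : Measurable fun z : (Fin n → ℝ) × (Fin n → ℝ) => (z.1 i, z.2 i) :=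
    ((measurable_pi_apply i).comp measurable_fst).prodMk
      ((measurable_pi_apply i).comp measurable_snd)
  exact hβ.measurable.comp h

lemma integrable_apply (ρ : Measure ((Fin n → ℝ) × (Fin n → ℝ))) [IsFiniteMeasure ρ] (i : Fin n) :
    Integrable (fun z => β (z.1 i) (z.2 i)) ρ :=
  Integrable.of_bound (hβ.measurable_apply i).aestronglyMeasurable 1 <| ae_of_all _ fun z => by
    rw [Real.norm_of_nonneg (hβ.nonneg _ _)]
    exact hβ.le_one _ _

lemma integrable_sum (ρ : Measure ((Fin n → ℝ) × (Fin n → ℝ))) [IsFiniteMeasure ρ]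
    (w : Fin n → ℝ) : Integrable (fun z => ∑ i, w i * β (z.1 i) (z.2 i)) ρ :=
  integrable_finsetSum _ fun i _ => (hβ.integrable_apply ρ i).const_mul _

lemma integral_sum_le (ρ : Measure ((Fin n → ℝ) × (Fin n → ℝ))) [IsProbabilityMeasure ρ]
    {w : Fin n → ℝ} (hw : ∀ i, 0 ≤ w i) : ∫ z, ∑ i, w i * β (z.1 i) (z.2 i) ∂ρ ≤ ∑ i, w i := by
  have := integral_mono (hβ.integrable_sum ρ w) (integrable_const (∑ i, w i)) fun z =>
    Finset.sum_le_sum fun i _ => mul_le_of_le_one_right (hw i) (hβ.le_one _ _)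
  simpa using this

lemma integral_sum_nonneg (ρ : Measure ((Fin n → ℝ) × (Fin n → ℝ)))
    {w : Fin n → ℝ} (hw : ∀ i, 0 ≤ w i) : 0 ≤ ∫ z, ∑ i, w i * β (z.1 i) (z.2 i) ∂ρ :=
  integral_nonneg fun _ => Finset.sum_nonneg fun i _ => mul_nonneg (hw i) (hβ.nonneg _ _)

end IsWinRule

/-! ### Winning probabilities after rescaling -/

/-- Against the rescaled independent bids, a bid of `x` wins (or ties) at most as often as against
the bids themselves, up to the relative error of the total. -/
lemma map_rescale_real_le {n : ℕ} {Y η δ : ℝ} {b c : Fin n → ℝ} (hY : 0 < Y)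
    (hb : ∀ i, 0 ≤ b i) (hb1 : ∀ i, b i ≤ 1) (hc : ∀ i, 0 < c i) (hη : 0 ≤ η) (hη1 : η < 1)
    (hδ : (Measure.pi fun i => atomUniform (b i) (c i)).real (deviantSet n Y η) ≤ δ)
    (i : Fin n) {x : ℝ} (hx : 0 ≤ x) :
    ((Measure.pi fun i => atomUniform (b i) (c i)).map (rescale Y)).real {y | y i ≤ x} ≤
      b i + (1 - b i) * (x / c i) + η + δ := by
  have := fun i => isProbabilityMeasure_atomUniform (hb i) (hb1 i) (hc i)
  have hm : MeasurableSet {y : Fin n → ℝ | y i ≤ x} :=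
    measurableSet_le (measurable_pi_apply i) measurable_const
  rw [map_measureReal_apply (measurable_rescale Y) hm]
  have hsub : rescale Y ⁻¹' {y : Fin n → ℝ | y i ≤ x} ⊆
      Function.eval i ⁻¹' Set.Iic (x * (1 + η)) ∪ deviantSet n Y η := by
    intro y hy
    by_cases h : y ∈ deviantSet n Y η
    · exact Or.inr h
    · left
      obtain ⟨h1, h2⟩ := sum_mem_Ioo_of_notMem_deviantSet h
      have hS : 0 < ∑ j, y j := lt_of_le_of_lt (mul_nonneg (by linarith) hY.le) h1
      have hy' : y i / (∑ j, y j) * Y ≤ x := by simpa [rescale, hS.ne'] using hy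
      rw [div_mul_eq_mul_div, div_le_iff₀ hS] at hy'
      -- The total of `y` is below `(1 + η) * Y`, so a rescaled bid at most `x` comes from a bid at
      -- most `x * (1 + η)`.
      have h3 : y i * Y ≤ x * (1 + η) * Y := by nlinarith
      exact le_of_mul_le_mul_right h3 hY
  have hev : (Measure.pi fun i => atomUniform (b i) (c i)).real
      (Function.eval i ⁻¹' Set.Iic (x * (1 + η))) =
      (atomUniform (b i) (c i)).real (Set.Iic (x * (1 + η))) :=
    (measurePreserving_eval (fun i => atomUniform (b i) (c i)) i).measureReal_preimage
      measurableSet_Iic.nullMeasurableSet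
  have h1 := atomUniform_real_Iic_mul_le (hb i) (hb1 i) (hc i) hx hη
  have h2 := (measureReal_mono (μ := Measure.pi fun i => atomUniform (b i) (c i)) hsub
    (measure_ne_top _ _)).trans (measureReal_union_le _ _)
  rw [hev] at h2
  linarith

/-- The rescaled independent bids win at least as often as the bids themselves, the player's bid
being shrunk, up to the relative errors of the totals. -/
lemma le_prod_map_rescale_real_lt {n : ℕ} {X Y η δ : ℝ} {a b c : Fin n → ℝ} (hX : 0 < X)
    (hY : 0 < Y) (ha : ∀ i, 0 ≤ a i) (ha1 : ∀ i, a i ≤ 1) (hb : ∀ i, 0 ≤ b i)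
    (hb1 : ∀ i, b i ≤ 1) (hc : ∀ i, 0 < c i) (hη : 0 ≤ η) (hη1 : η < 1)
    (hδa : (Measure.pi fun i => atomUniform (a i) (c i)).real (deviantSet n X η) ≤ δ)
    (hδb : (Measure.pi fun i => atomUniform (b i) (c i)).real (deviantSet n Y η) ≤ δ)
    (i : Fin n) :
    (1 - a i) * (b i + (1 - b i) * ((1 - η) / (1 + η)) / 2) - 2 * δ ≤
      (((Measure.pi fun i => atomUniform (a i) (c i)).map (rescale X)).prod
        ((Measure.pi fun i => atomUniform (b i) (c i)).map (rescale Y))).real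
          {z | z.2 i < z.1 i} := by
  have hpa := fun i => isProbabilityMeasure_atomUniform (ha i) (ha1 i) (hc i)
  have hpb := fun i => isProbabilityMeasure_atomUniform (hb i) (hb1 i) (hc i)
  set μ := fun i => atomUniform (a i) (c i)
  set ν := fun i => atomUniform (b i) (c i)
  set τ := (1 - η) / (1 + η) with hτ
  have hτ0 : 0 < τ := div_pos (by linarith) (by linarith)
  have hτ1 : τ ≤ 1 := (div_le_one (by linarith)).2 (by linarith)
  have hm : MeasurableSet {z : (Fin n → ℝ) × (Fin n → ℝ) | z.2 i < z.1 i} :=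
    measurableSet_lt ((measurable_pi_apply i).comp measurable_snd)
      ((measurable_pi_apply i).comp measurable_fst)
  rw [Measure.map_prod_map _ _ (measurable_rescale X) (measurable_rescale Y),
    map_measureReal_apply ((measurable_rescale X).prodMap (measurable_rescale Y)) hm]
  have hmA : MeasurableSet (deviantSet n X η) := measurableSet_le measurable_const
    ((Finset.measurable_sum _ fun i _ => measurable_pi_apply i).sub_const X).abs
  have hmB : MeasurableSet (deviantSet n Y η) := measurableSet_le measurable_const
    ((Finset.measurable_sum _ fun i _ => measurable_pi_apply i).sub_const Y).abs
  -- The last set is null. It is split off because the comparison of the rescaled bids needs `0 ≤ y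
  -- i`, which also forces `0 < x i`.
  have hsub : Prod.map (Function.eval i) (Function.eval i) ⁻¹' {z : ℝ × ℝ | z.2 < τ * z.1} ⊆
      ((Prod.map (rescale X) (rescale Y) ⁻¹' {z : (Fin n → ℝ) × (Fin n → ℝ) | z.2 i < z.1 i} ∪
        Prod.fst ⁻¹' deviantSet n X η) ∪ Prod.snd ⁻¹' deviantSet n Y η) ∪
        (fun z : (Fin n → ℝ) × (Fin n → ℝ) => z.2 i) ⁻¹' (Set.Icc 0 (c i))ᶜ := by
    rintro ⟨x, y⟩ hxy
    by_cases h0 : y i ∈ Set.Icc 0 (c i)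
    swap
    · exact Or.inr h0
    left
    by_cases hyd : y ∈ deviantSet n Y η
    · exact Or.inr hyd
    left
    by_cases hxd : x ∈ deviantSet n X η
    · exact Or.inr hxd
    left
    obtain ⟨hx1, hx2⟩ := sum_mem_Ioo_of_notMem_deviantSet hxd
    obtain ⟨hy1, hy2⟩ := sum_mem_Ioo_of_notMem_deviantSet hyd
    have hSx : 0 < ∑ j, x j := lt_of_le_of_lt (mul_nonneg (by linarith) hX.le) hx1
    have hSy : 0 < ∑ j, y j := lt_of_le_of_lt (mul_nonneg (by linarith) hY.le) hy1
    have hxy' : y i < τ * x i := hxy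
    have hxi : 0 < x i := pos_of_mul_pos_right (h0.1.trans_lt hxy') hτ0.le
    have hlt : y i * (1 + η) < x i * (1 - η) := by
      rw [hτ, div_mul_eq_mul_div, lt_div_iff₀ (by linarith)] at hxy'
      linarith
    have goal : y i / (∑ j, y j) * Y < x i / (∑ j, x j) * X := by
      rw [div_mul_eq_mul_div, div_mul_eq_mul_div, div_lt_div_iff₀ hSy hSx]
      have e1 : y i * Y * ∑ j, x j ≤ y i * Y * ((1 + η) * X) :=
        mul_le_mul_of_nonneg_left hx2.le (mul_nonneg h0.1 hY.le)
      have e2 : x i * X * ((1 - η) * Y) ≤ x i * X * ∑ j, y j :=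
        mul_le_mul_of_nonneg_left hy1.le (mul_pos hxi hX).le
      have e3 := mul_lt_mul_of_pos_right hlt (mul_pos hX hY)
      nlinarith
    simpa [rescale, hSx.ne', hSy.ne'] using goal
  have hev : ((Measure.pi μ).prod (Measure.pi ν)).real
      (Prod.map (Function.eval i) (Function.eval i) ⁻¹' {z : ℝ × ℝ | z.2 < τ * z.1}) =
      ((μ i).prod (ν i)).real {z | z.2 < τ * z.1} :=
    ((measurePreserving_eval μ i).prod (measurePreserving_eval ν i)).measureReal_preimage
      (measurableSet_lt measurable_snd (measurable_fst.const_mul τ)).nullMeasurableSet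
  have hAe : ((Measure.pi μ).prod (Measure.pi ν)).real (Prod.fst ⁻¹' deviantSet n X η) =
      (Measure.pi μ).real (deviantSet n X η) :=
    measurePreserving_fst.measureReal_preimage hmA.nullMeasurableSet
  have hBe : ((Measure.pi μ).prod (Measure.pi ν)).real (Prod.snd ⁻¹' deviantSet n Y η) =
      (Measure.pi ν).real (deviantSet n Y η) :=
    measurePreserving_snd.measureReal_preimage hmB.nullMeasurableSet
  have hCe : ((Measure.pi μ).prod (Measure.pi ν)).real
      ((fun z : (Fin n → ℝ) × (Fin n → ℝ) => z.2 i) ⁻¹' (Set.Icc 0 (c i))ᶜ) = 0 := by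
    have h := ((measurePreserving_eval ν i).comp (measurePreserving_snd
      (μ := Measure.pi μ) (ν := Measure.pi ν))).measureReal_preimage
        (measurableSet_Icc (a := 0) (b := c i)).compl.nullMeasurableSet
    refine Eq.trans h ?_
    rw [measureReal_def, show ν i (Set.Icc 0 (c i))ᶜ = 0 from
      ae_iff.1 (atomUniform_ae_mem_Icc (b i) (hc i))]
    rfl
  have h1 := le_atomUniform_prod_real_lt (ha i) (ha1 i) (hb i) (hb1 i) (hc i) hτ0 hτ1
  have h2 := measureReal_mono (μ := (Measure.pi μ).prod (Measure.pi ν)) hsub (measure_ne_top _ _)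
  rw [hev] at h2
  have h3 := h2.trans (measureReal_union_le _ _)
  have h4 := h3.trans (add_le_add_left (measureReal_union_le _ _) _)
  have h5 := h4.trans (add_le_add_left (add_le_add_left (measureReal_union_le _ _) _) _)
  rw [hAe, hBe, hCe] at h5
  linarith

/-! ### Payoff bounds for uniform profiles -/

namespace IsUniformProfile

variable {n : ℕ} {X Y L η δ : ℝ} {w a b c : Fin n → ℝ} (h : IsUniformProfile X Y L w a b c)
include h

/-- Converts an error relative to `L * X` into one relative to the total value: by the slope
condition, `L * X` is the sum of `w i * (1 - a i) * (1 - b i) / 2`. -/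
lemma slope_mul_le : L * X ≤ (∑ i, w i) / 2 := by
  rw [← h.sum_a, Finset.mul_sum, Finset.sum_div]
  refine Finset.sum_le_sum fun i _ => ?_
  have h1 : L * ((1 - a i) * c i / 2) = w i * ((1 - b i) * (1 - a i)) / 2 := by
    linear_combination (-(1 - a i) / 2) * h.slope i
  have h2 : (1 - b i) * (1 - a i) ≤ 1 :=
    mul_le_one₀ (by linarith [h.b_nonneg i]) (by linarith [h.a_le_one i])
      (by linarith [h.a_nonneg i])
  rw [h1]
  have := mul_le_of_le_one_right (h.w_nonneg i) h2
  linarith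

/-- No pure strategy earns much more than `∑ w b + L X` against the rescaled bids. -/
lemma integral_le {β : ℝ → ℝ → ℝ} (hβ : IsWinRule β) (hY : 0 < Y) (hη : 0 ≤ η) (hη1 : η < 1)
    (hδ : (Measure.pi fun i => atomUniform (b i) (c i)).real (deviantSet n Y η) ≤ δ)
    {s : Measure (Fin n → ℝ)} (hs : IsMixedStrategy X s) :
    ∫ z, ∑ i, w i * β (z.1 i) (z.2 i)
      ∂s.prod ((Measure.pi fun i => atomUniform (b i) (c i)).map (rescale Y)) ≤
      ∑ i, w i * b i + L * X + (η + δ) * ∑ i, w i := by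
  have hpb := fun i => isProbabilityMeasure_atomUniform (h.b_nonneg i) (h.b_le_one i) (h.c_pos i)
  have := hs.1
  set t := (Measure.pi fun i => atomUniform (b i) (c i)).map (rescale Y) with ht
  have : IsProbabilityMeasure t :=
    Measure.isProbabilityMeasure_map (measurable_rescale Y).aemeasurable
  have hint := hβ.integrable_sum (s.prod t) w
  rw [integral_prod _ hint]
  have key : ∀ᵐ x ∂s, ∫ y, ∑ i, w i * β (x i) (y i) ∂t ≤
      ∑ i, w i * b i + L * X + (η + δ) * ∑ i, w i := by
    filter_upwards [hs.2] with x hx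
    have hm : ∀ i, Measurable fun y : Fin n → ℝ => β (x i) (y i) := fun i =>
      hβ.measurable.comp (measurable_const.prodMk (measurable_pi_apply i))
    have hi : ∀ i, Integrable (fun y : Fin n → ℝ => β (x i) (y i)) t := fun i =>
      Integrable.of_bound (hm i).aestronglyMeasurable 1 <| ae_of_all _ fun z => by
        rw [Real.norm_of_nonneg (hβ.nonneg _ _)]
        exact hβ.le_one _ _
    rw [integral_finsetSum _ fun i _ => (hi i).const_mul _]
    have h1 : ∀ i, ∫ y, w i * β (x i) (y i) ∂t ≤ w i * b i + L * x i + (η + δ) * w i := by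
      intro i
      have hms : MeasurableSet {y : Fin n → ℝ | y i ≤ x i} :=
        measurableSet_le (measurable_pi_apply i) measurable_const
      -- Ties are counted as wins here and as losses in the lower bound, so the tie-breaking rule
      -- plays no role.
      have h2 : ∫ y, β (x i) (y i) ∂t ≤ t.real {y | y i ≤ x i} := by
        rw [← integral_indicator_one hms]
        refine integral_mono (hi i) ((integrable_const (1 : ℝ)).indicator hms) fun y => ?_
        by_cases hy : y i ≤ x i
        · simpa [Set.indicator, hy] using hβ.le_one _ _
        · simp [Set.indicator, hy, hβ.of_gt _ _ (not_le.1 hy)]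
      have h3 := h2.trans (map_rescale_real_le hY h.b_nonneg h.b_le_one h.c_pos hη hη1 hδ i
        (hx.1 i))
      rw [integral_const_mul]
      refine (mul_le_mul_of_nonneg_left h3 (h.w_nonneg i)).trans (le_of_eq ?_)
      have hc := (h.c_pos i).ne'
      have h4 : w i * ((1 - b i) * (x i / c i)) = L * x i := by
        rw [← mul_assoc, h.slope i]
        field_simp
      linear_combination h4
    refine (Finset.sum_le_sum fun i _ => h1 i).trans ?_
    rw [Finset.sum_add_distrib, Finset.sum_add_distrib, ← Finset.mul_sum, ← Finset.mul_sum]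
    have := mul_le_mul_of_nonneg_left hx.2 h.slope_nonneg
    linarith
  have := integral_mono_ae hint.integral_prod_left
    (integrable_const (∑ i, w i * b i + L * X + (η + δ) * ∑ i, w i)) key
  simpa using this

/-- The rescaled bids earn almost `∑ w b + L X`. -/
lemma le_integral {β : ℝ → ℝ → ℝ} (hβ : IsWinRule β) (hX : 0 < X) (hY : 0 < Y) (hη : 0 ≤ η)
    (hη1 : η < 1)
    (hδa : (Measure.pi fun i => atomUniform (a i) (c i)).real (deviantSet n X η) ≤ δ)
    (hδb : (Measure.pi fun i => atomUniform (b i) (c i)).real (deviantSet n Y η) ≤ δ) :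
    ∑ i, w i * b i + L * X - (η + 2 * δ) * ∑ i, w i ≤
      ∫ z, ∑ i, w i * β (z.1 i) (z.2 i)
        ∂((Measure.pi fun i => atomUniform (a i) (c i)).map (rescale X)).prod
          ((Measure.pi fun i => atomUniform (b i) (c i)).map (rescale Y)) := by
  have hpa := fun i => isProbabilityMeasure_atomUniform (h.a_nonneg i) (h.a_le_one i) (h.c_pos i)
  have hpb := fun i => isProbabilityMeasure_atomUniform (h.b_nonneg i) (h.b_le_one i) (h.c_pos i)
  have hlow := le_prod_map_rescale_real_lt hX hY h.a_nonneg h.a_le_one h.b_nonneg h.b_le_one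
    h.c_pos hη hη1 hδa hδb
  set s := (Measure.pi fun i => atomUniform (a i) (c i)).map (rescale X)
  set t := (Measure.pi fun i => atomUniform (b i) (c i)).map (rescale Y)
  have : IsProbabilityMeasure s :=
    Measure.isProbabilityMeasure_map (measurable_rescale X).aemeasurable
  have : IsProbabilityMeasure t :=
    Measure.isProbabilityMeasure_map (measurable_rescale Y).aemeasurable
  rw [integral_finsetSum _ fun i _ => (hβ.integrable_apply (s.prod t) i).const_mul _]
  set τ := (1 - η) / (1 + η) with hτ
  have h1 : ∀ i, w i * b i + τ * (L * ((1 - a i) * c i / 2)) - 2 * δ * w i ≤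
      ∫ z, w i * β (z.1 i) (z.2 i) ∂s.prod t := by
    intro i
    have hms : MeasurableSet {z : (Fin n → ℝ) × (Fin n → ℝ) | z.2 i < z.1 i} :=
      measurableSet_lt ((measurable_pi_apply i).comp measurable_snd)
        ((measurable_pi_apply i).comp measurable_fst)
    have h2 : (s.prod t).real {z | z.2 i < z.1 i} ≤ ∫ z, β (z.1 i) (z.2 i) ∂s.prod t := by
      rw [← integral_indicator_one hms]
      refine integral_mono ((integrable_const (1 : ℝ)).indicator hms)
        (hβ.integrable_apply _ i) fun z => ?_
      by_cases hz : z.2 i < z.1 i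
      · simp [Set.indicator, hz, hβ.of_lt _ _ hz]
      · simpa [Set.indicator, hz] using hβ.nonneg _ _
    rw [integral_const_mul]
    refine le_trans (le_of_eq ?_) (mul_le_mul_of_nonneg_left ((hlow i).trans h2) (h.w_nonneg i))
    -- At most one player has an atom, so `(1 - a i) * b i = b i`; the slope condition turns `w i *
    -- (1 - b i)` into `L * c i`.
    linear_combination w i * h.mul_eq_zero i - (τ * (1 - a i) / 2) * h.slope i
  refine le_trans ?_ (Finset.sum_le_sum fun i _ => h1 i)
  rw [Finset.sum_sub_distrib, Finset.sum_add_distrib, ← Finset.mul_sum, ← Finset.mul_sum,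
    ← Finset.mul_sum, h.sum_a]
  -- Shrinking by `τ` loses `(1 - τ) * L * X ≤ 2 * η * (L * X)`, which is at most `η * ∑ w` by
  -- `slope_mul_le`.
  have h3 : 1 - τ ≤ 2 * η := by
    rw [hτ, sub_le_iff_le_add, ← sub_le_iff_le_add', le_div_iff₀ (by linarith)]
    nlinarith
  have h4 := mul_le_mul_of_nonneg_right h3 (mul_nonneg h.slope_nonneg hX.le)
  have h5 := mul_le_mul_of_nonneg_left h.slope_mul_le (mul_nonneg zero_le_two hη)
  linarith

/-- The error is `η + δ` from the bound on deviations plus `η + 2δ` from the payoff of the profile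
itself. -/
lemma integral_le_integral_add {β : ℝ → ℝ → ℝ} (hβ : IsWinRule β) (hX : 0 < X) (hY : 0 < Y)
    (hη : 0 ≤ η)
    (hδa : (Measure.pi fun i => atomUniform (a i) (c i)).real (deviantSet n X η) ≤ δ)
    (hδb : (Measure.pi fun i => atomUniform (b i) (c i)).real (deviantSet n Y η) ≤ δ)
    {s : Measure (Fin n → ℝ)} (hs : IsMixedStrategy X s) :
    ∫ z, ∑ i, w i * β (z.1 i) (z.2 i)
      ∂s.prod ((Measure.pi fun i => atomUniform (b i) (c i)).map (rescale Y)) ≤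
      ∫ z, ∑ i, w i * β (z.1 i) (z.2 i)
        ∂((Measure.pi fun i => atomUniform (a i) (c i)).map (rescale X)).prod
          ((Measure.pi fun i => atomUniform (b i) (c i)).map (rescale Y)) +
      (2 * η + 3 * δ) * ∑ i, w i := by
  have hW : 0 ≤ ∑ i, w i := Finset.sum_nonneg fun i _ => h.w_nonneg i
  -- For `1 ≤ η` the error term alone exceeds `∑ w`, and payoffs lie between `0` and `∑ w`.
  rcases lt_or_ge η 1 with hη1 | hη1
  · have h1 := h.integral_le hβ hY hη hη1 hδb hs
    have h2 := h.le_integral hβ hX hY hη hη1 hδa hδb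
    linarith
  · have hpb := fun i =>
      isProbabilityMeasure_atomUniform (h.b_nonneg i) (h.b_le_one i) (h.c_pos i)
    have := hs.1
    have : IsProbabilityMeasure
        ((Measure.pi fun i => atomUniform (b i) (c i)).map (rescale Y)) :=
      Measure.isProbabilityMeasure_map (measurable_rescale Y).aemeasurable
    have h1 := hβ.integral_sum_le
      (s.prod ((Measure.pi fun i => atomUniform (b i) (c i)).map (rescale Y))) h.w_nonneg
    have h2 := hβ.integral_sum_nonneg
      (((Measure.pi fun i => atomUniform (a i) (c i)).map (rescale X)).prod
          ((Measure.pi fun i => atomUniform (b i) (c i)).map (rescale Y))) h.w_nonneg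
    have hδ : 0 ≤ δ := measureReal_nonneg.trans hδa
    nlinarith

end IsUniformProfile

/-- Concentration of the total of independent uniform-type bids. -/
lemma pi_atomUniform_real_deviantSet_le {n : ℕ} {X η R : ℝ} {a c : Fin n → ℝ} (hX : 0 < X)
    (ha : ∀ i, 0 ≤ a i) (ha1 : ∀ i, a i ≤ 1) (hc : ∀ i, 0 < c i) (hη : 0 ≤ η) (hR : 0 ≤ R)
    (hcR : ∀ i, c i ≤ R) (hsum : ∑ i, (1 - a i) * c i / 2 = X) :
    (Measure.pi fun i => atomUniform (a i) (c i)).real (deviantSet n X η) ≤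
      2 * Real.exp (-(2 * (η * X) ^ 2 / (n * R ^ 2))) := by
  have hpa := fun i => isProbabilityMeasure_atomUniform (ha i) (ha1 i) (hc i)
  have h := pi_real_abs_sum_sub_integral_ge_le hR (mul_nonneg hη hX.le)
    (fun i => atomUniform (a i) (c i)) fun i => by
      filter_upwards [atomUniform_ae_mem_Icc (a i) (hc i)] with x hx
        using ⟨hx.1, hx.2.trans (hcR i)⟩
  simp only [integral_id_atomUniform (ha _) (ha1 _) (hc _)] at h
  rwa [hsum] at h

lemma isWinRule_blottoA {α : ℝ} (h0 : 0 ≤ α) (h1 : α ≤ 1) : IsWinRule (blottoA α) where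
  measurable := Measurable.ite (measurableSet_lt measurable_snd measurable_fst) measurable_const
    (Measurable.ite (measurableSet_eq_fun measurable_fst measurable_snd) measurable_const
      measurable_const)
  nonneg x y := by unfold blottoA; split_ifs <;> simp [h0]
  le_one x y := by unfold blottoA; split_ifs <;> simp [h1]
  of_lt x y h := by simp [blottoA, h]
  of_gt x y h := by simp [blottoA, h.ne, h.le]

lemma isWinRule_blottoB {α : ℝ} (h0 : 0 ≤ α) (h1 : α ≤ 1) :
    IsWinRule (fun y x => blottoB α x y) where
  measurable := Measurable.ite (measurableSet_lt measurable_snd measurable_fst) measurable_const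
    (Measurable.ite (measurableSet_eq_fun measurable_snd measurable_fst) measurable_const
      measurable_const)
  nonneg x y := by unfold blottoB; split_ifs <;> simp [h1]
  le_one x y := by unfold blottoB; split_ifs <;> simp [h0]
  of_lt x y h := by simp [blottoB, h]
  of_gt x y h := by simp [blottoB, h.ne', h.le]

/-! ### The game as a uniform profile -/

namespace GCBGame

variable {n : ℕ} {X_A X_B : ℝ} (G : GCBGame n X_A X_B)

/-- Puts player B in the first coordinate, so that the results on uniform profiles apply with the
roles exchanged. -/
lemma payoffB_eq (s t : Measure (Fin n → ℝ)) [SFinite s] [SFinite t] : G.payoffB s t =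
    ∫ z, ∑ i, G.wB i * (fun y x => blottoB G.α x y) (z.1 i) (z.2 i) ∂t.prod s := by
  rw [payoffB, ← integral_prod_swap]
  rfl

include G in
lemma nonempty_fin : Nonempty (Fin n) := ⟨⟨0, by linarith [G.three_le]⟩⟩

include G in
lemma budgetB_pos : 0 < X_B := G.budgetA_pos.trans_le G.budget_le

lemma totalA_pos : 0 < G.totalA :=
  have := G.nonempty_fin
  Finset.sum_pos (fun i _ => G.wA_pos i) Finset.univ_nonempty

lemma totalB_pos : 0 < G.totalB :=
  have := G.nonempty_fin
  Finset.sum_pos (fun i _ => G.wB_pos i) Finset.univ_nonempty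

lemma vA_pos (i : Fin n) : 0 < G.vA i := div_pos (G.wA_pos i) G.totalA_pos

lemma vB_pos (i : Fin n) : 0 < G.vB i := div_pos (G.wB_pos i) G.totalB_pos

lemma totalA_mul_vA (i : Fin n) : G.totalA * G.vA i = G.wA i :=
  mul_div_cancel₀ _ G.totalA_pos.ne'

lemma totalB_mul_vB (i : Fin n) : G.totalB * G.vB i = G.wB i :=
  mul_div_cancel₀ _ G.totalB_pos.ne'

lemma sum_vB : ∑ i, G.vB i = 1 := by
  simp only [vB, ← Finset.sum_div]
  exact div_self G.totalB_pos.ne'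

lemma mem_OmegaA {γ : ℝ} {i : Fin n} : i ∈ G.OmegaA γ ↔ γ < G.vA i / G.vB i := by
  simp [OmegaA]

lemma sum_OmegaA_add_sum_compl (γ : ℝ) (f g : Fin n → ℝ) :
    ∑ i ∈ G.OmegaA γ, f i + ∑ i ∈ (G.OmegaA γ)ᶜ, g i =
      ∑ i, if i ∈ G.OmegaA γ then f i else g i := by
  rw [Finset.sum_ite]
  congr 1
  · simp
  · refine Finset.sum_congr ?_ fun _ _ => rfl
    ext i
    simp

lemma two_mul_lambdaA (γ : ℝ) : 2 * X_B * G.lambdaA γ =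
    ∑ i, if i ∈ G.OmegaA γ then γ ^ 2 * (G.vB i ^ 2 / G.vA i) else G.vA i := by
  have := G.budgetB_pos.ne'
  rw [← G.sum_OmegaA_add_sum_compl, ← Finset.mul_sum, lambdaA]
  field_simp

lemma two_mul_lambdaB {γ : ℝ} (hγ : 0 < γ) : 2 * X_A * G.lambdaB γ =
    ∑ i, if i ∈ G.OmegaA γ then G.vB i else 1 / γ ^ 2 * (G.vA i ^ 2 / G.vB i) := by
  have := G.budgetA_pos.ne'
  rw [← G.sum_OmegaA_add_sum_compl, ← Finset.mul_sum, lambdaB]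
  field_simp

lemma lambdaA_pos {γ : ℝ} (hγ : 0 < γ) : 0 < G.lambdaA γ := by
  have := G.nonempty_fin
  have h : 0 < 2 * X_B * G.lambdaA γ := by
    rw [two_mul_lambdaA]
    refine Finset.sum_pos (fun i _ => ?_) Finset.univ_nonempty
    have := G.vA_pos i
    have := G.vB_pos i
    split_ifs <;> positivity
  exact pos_of_mul_pos_right h (by linarith [G.budgetB_pos])

lemma lambdaB_pos {γ : ℝ} (hγ : 0 < γ) : 0 < G.lambdaB γ := by
  have := G.nonempty_fin
  have h : 0 < 2 * X_A * G.lambdaB γ := by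
    rw [G.two_mul_lambdaB hγ]
    refine Finset.sum_pos (fun i _ => ?_) Finset.univ_nonempty
    have := G.vA_pos i
    have := G.vB_pos i
    split_ifs <;> positivity
  exact pos_of_mul_pos_right h (by linarith [G.budgetA_pos])

/-- The right-hand side of the equation defining `solutions` is `(2 * X_B * λ_A) / (2 * X_A * λ_B)`.
-/
lemma lambdaA_eq {γ : ℝ} (hγ : γ ∈ G.solutions) : G.lambdaA γ = γ * G.lambdaB γ := by
  obtain ⟨h0, h⟩ := hγ
  have hA := G.budgetA_pos
  have hB := G.budgetB_pos
  have hl := G.lambdaB_pos h0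
  rw [Finset.mul_sum, Finset.mul_sum, G.sum_OmegaA_add_sum_compl, G.sum_OmegaA_add_sum_compl,
    ← G.two_mul_lambdaA, ← G.two_mul_lambdaB h0, div_eq_div_iff hA.ne' (by positivity)] at h
  have h2 : 2 * X_A * X_B ≠ 0 := by positivity
  refine mul_left_cancel₀ h2 ?_
  linear_combination -h

/-- The atom at `0` of the distribution `distA`. -/
noncomputable def atomA (γ : ℝ) (i : Fin n) : ℝ :=
  if i ∈ G.OmegaA γ then 0
  else (G.vB i / G.lambdaB γ - G.vA i / G.lambdaA γ) / (G.vB i / G.lambdaB γ)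

/-- The atom at `0` of the distribution `distB`. -/
noncomputable def atomB (γ : ℝ) (i : Fin n) : ℝ :=
  if i ∈ G.OmegaA γ then
    (G.vA i / G.lambdaA γ - G.vB i / G.lambdaB γ) / (G.vA i / G.lambdaA γ)
  else 0

/-- The common maximum of the supports of `distA` and `distB`. -/
noncomputable def cap (γ : ℝ) (i : Fin n) : ℝ :=
  if i ∈ G.OmegaA γ then G.vB i / G.lambdaB γ else G.vA i / G.lambdaA γ

lemma distA_eq (γ : ℝ) : G.distA γ = fun i => atomUniform (G.atomA γ i) (G.cap γ i) := by
  ext1 i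
  by_cases h : i ∈ G.OmegaA γ <;> simp [distA, atomA, cap, h]

lemma distB_eq (γ : ℝ) : G.distB γ = fun i => atomUniform (G.atomB γ i) (G.cap γ i) := by
  ext1 i
  by_cases h : i ∈ G.OmegaA γ <;> simp [distB, atomB, cap, h]

section Solution

variable {γ : ℝ} (hγ : γ ∈ G.solutions)
include hγ

/-- Thus `cap` is the smaller of `p_i = vA / λ_A` and `q_i = vB / λ_B`, and the atoms are
nonnegative. -/
lemma mem_OmegaA_iff_lt {i : Fin n} :
    i ∈ G.OmegaA γ ↔ G.vB i / G.lambdaB γ < G.vA i / G.lambdaA γ := by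
  have hA := G.lambdaA_pos hγ.1
  have hB := G.lambdaB_pos hγ.1
  rw [mem_OmegaA, lt_div_iff₀ (G.vB_pos i), div_lt_div_iff₀ hB hA, G.lambdaA_eq hγ,
    ← mul_lt_mul_iff_left₀ hB]
  constructor <;> intro h <;> linarith

lemma cap_pos (i : Fin n) : 0 < G.cap γ i := by
  have hA := G.lambdaA_pos hγ.1
  have hB := G.lambdaB_pos hγ.1
  have := G.vA_pos i
  have := G.vB_pos i
  unfold cap
  split_ifs <;> positivity

lemma cap_le (i : Fin n) : G.cap γ i ≤ G.vA i / G.lambdaA γ := by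
  unfold cap
  split_ifs with h
  · exact ((G.mem_OmegaA_iff_lt hγ).1 h).le
  · exact le_rfl

lemma atomA_nonneg (i : Fin n) : 0 ≤ G.atomA γ i := by
  unfold atomA
  split_ifs with h
  · exact le_rfl
  · rw [G.mem_OmegaA_iff_lt hγ, not_lt] at h
    exact div_nonneg (sub_nonneg.2 h) (div_pos (G.vB_pos i) (G.lambdaB_pos hγ.1)).le

lemma atomB_nonneg (i : Fin n) : 0 ≤ G.atomB γ i := by
  unfold atomB
  split_ifs with h
  · rw [G.mem_OmegaA_iff_lt hγ] at h
    exact div_nonneg (sub_nonneg.2 h.le) (div_pos (G.vA_pos i) (G.lambdaA_pos hγ.1)).le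
  · exact le_rfl

lemma atomA_le_one (i : Fin n) : G.atomA γ i ≤ 1 := by
  have hp := div_pos (G.vA_pos i) (G.lambdaA_pos hγ.1)
  have hq := div_pos (G.vB_pos i) (G.lambdaB_pos hγ.1)
  unfold atomA
  split_ifs with h
  · exact zero_le_one
  · rw [div_le_one hq]
    linarith

lemma atomB_le_one (i : Fin n) : G.atomB γ i ≤ 1 := by
  have hp := div_pos (G.vA_pos i) (G.lambdaA_pos hγ.1)
  have hq := div_pos (G.vB_pos i) (G.lambdaB_pos hγ.1)
  unfold atomB
  split_ifs with h
  · rw [div_le_one hp]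
    linarith
  · exact zero_le_one

omit hγ in
lemma atomA_mul_atomB (γ : ℝ) (i : Fin n) : G.atomA γ i * G.atomB γ i = 0 := by
  unfold atomA atomB
  split_ifs <;> simp

/-- The expected bids, multiplied by `2 * λ_B`, are the summands in the definition of `λ_B`. Outside
`Ω_A` the bid has mean `p_i ^ 2 / (2 * q_i)`, and `λ_A = γ * λ_B` produces the factor `1 / γ ^ 2`.
-/
lemma sum_atomA : ∑ i, (1 - G.atomA γ i) * G.cap γ i / 2 = X_A := by
  have h0 := hγ.1
  have hB := G.lambdaB_pos h0
  have hl : 2 * G.lambdaB γ ≠ 0 := by positivity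
  refine mul_left_cancel₀ hl ?_
  rw [Finset.mul_sum, show 2 * G.lambdaB γ * X_A = 2 * X_A * G.lambdaB γ by ring,
    G.two_mul_lambdaB h0]
  refine Finset.sum_congr rfl fun i _ => ?_
  have := G.vA_pos i
  have := G.vB_pos i
  unfold atomA cap
  split_ifs
  · field_simp
    ring
  · rw [G.lambdaA_eq hγ]
    field_simp
    ring

lemma sum_atomB : ∑ i, (1 - G.atomB γ i) * G.cap γ i / 2 = X_B := by
  have h0 := hγ.1
  have hB := G.lambdaB_pos h0
  have hA := G.lambdaA_pos h0
  have hl : 2 * G.lambdaA γ ≠ 0 := by positivity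
  refine mul_left_cancel₀ hl ?_
  rw [Finset.mul_sum, show 2 * G.lambdaA γ * X_B = 2 * X_B * G.lambdaA γ by ring,
    G.two_mul_lambdaA]
  refine Finset.sum_congr rfl fun i _ => ?_
  have := G.vA_pos i
  have := G.vB_pos i
  unfold atomB cap
  split_ifs
  · rw [G.lambdaA_eq hγ]
    field_simp
    ring
  · field_simp
    ring

/-- The slope is constant because `w^A_i = W_A * λ_A * p_i`, while `1 - b i` is `q_i / p_i` on `Ω_A`
and `1` off it. -/
lemma isUniformProfile_A : IsUniformProfile X_A X_B (G.totalA * G.lambdaA γ) G.wA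
    (G.atomA γ) (G.atomB γ) (G.cap γ) where
  w_nonneg i := (G.wA_pos i).le
  a_nonneg := G.atomA_nonneg hγ
  a_le_one := G.atomA_le_one hγ
  b_nonneg := G.atomB_nonneg hγ
  b_le_one := G.atomB_le_one hγ
  c_pos := G.cap_pos hγ
  mul_eq_zero := G.atomA_mul_atomB γ
  slope_nonneg := (mul_pos G.totalA_pos (G.lambdaA_pos hγ.1)).le
  slope i := by
    have := G.vA_pos i
    have := G.lambdaA_pos hγ.1
    have := G.lambdaB_pos hγ.1
    rw [← G.totalA_mul_vA, atomB, cap]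
    split_ifs <;> field_simp <;> ring
  sum_a := G.sum_atomA hγ
  sum_b := G.sum_atomB hγ

lemma isUniformProfile_B : IsUniformProfile X_B X_A (G.totalB * G.lambdaB γ) G.wB
    (G.atomB γ) (G.atomA γ) (G.cap γ) where
  w_nonneg i := (G.wB_pos i).le
  a_nonneg := G.atomB_nonneg hγ
  a_le_one := G.atomB_le_one hγ
  b_nonneg := G.atomA_nonneg hγ
  b_le_one := G.atomA_le_one hγ
  c_pos := G.cap_pos hγ
  mul_eq_zero i := by rw [mul_comm, G.atomA_mul_atomB]
  slope_nonneg := (mul_pos G.totalB_pos (G.lambdaB_pos hγ.1)).le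
  slope i := by
    have := G.vB_pos i
    have := G.lambdaA_pos hγ.1
    have := G.lambdaB_pos hγ.1
    rw [← G.totalB_mul_vB, atomA, cap]
    split_ifs <;> field_simp <;> ring
  sum_a := G.sum_atomB hγ
  sum_b := G.sum_atomA hγ

/-- The independently uniform profile is an approximate equilibrium if the totals of the bids
concentrate around the budgets. -/
lemma isApproxEquilibrium_of_concentration {η δ : ℝ} (hη : 0 ≤ η)
    (hδA : (Measure.pi (G.distA γ)).real (deviantSet n X_A η) ≤ δ)
    (hδB : (Measure.pi (G.distB γ)).real (deviantSet n X_B η) ≤ δ) :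
    G.IsApproxEquilibrium ((2 * η + 3 * δ) * max G.totalA G.totalB) (G.iuA γ) (G.iuB γ) := by
  have hA := G.budgetA_pos
  have hB := G.budgetB_pos
  have hδ : 0 ≤ 2 * η + 3 * δ := by
    have : 0 ≤ δ := measureReal_nonneg.trans hδA
    positivity
  have hpA := fun i => isProbabilityMeasure_atomUniform (G.atomA_nonneg hγ i)
    (G.atomA_le_one hγ i) (G.cap_pos hγ i)
  have hpB := fun i => isProbabilityMeasure_atomUniform (G.atomB_nonneg hγ i)
    (G.atomB_le_one hγ i) (G.cap_pos hγ i)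
  have hmA : IsMixedStrategy X_A (G.iuA γ) := by
    rw [iuA, distA_eq]
    exact isMixedStrategy_map_rescale hA.le _ fun i =>
      (atomUniform_ae_mem_Icc _ (G.cap_pos hγ i)).mono fun x hx => hx.1
  have hmB : IsMixedStrategy X_B (G.iuB γ) := by
    rw [iuB, distB_eq]
    exact isMixedStrategy_map_rescale hB.le _ fun i =>
      (atomUniform_ae_mem_Icc _ (G.cap_pos hγ i)).mono fun x hx => hx.1
  have := hmA.1
  have := hmB.1
  rw [distA_eq] at hδA
  rw [distB_eq] at hδB
  refine ⟨hmA, hmB, fun s hs => ?_, fun t ht => ?_⟩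
  · have h := (G.isUniformProfile_A hγ).integral_le_integral_add
      (isWinRule_blottoA G.α_nonneg G.α_le_one) hA hB hη hδA hδB hs
    rw [← distA_eq, ← distB_eq] at h
    have h2 := mul_le_mul_of_nonneg_left (le_max_left G.totalA G.totalB) hδ
    exact h.trans (add_le_add_right h2 _)
  · have := ht.1
    have h := (G.isUniformProfile_B hγ).integral_le_integral_add
      (isWinRule_blottoB G.α_nonneg G.α_le_one) hB hA hη hδB hδA ht
    rw [← distA_eq, ← distB_eq] at h
    have h2 := mul_le_mul_of_nonneg_left (le_max_right G.totalA G.totalB) hδ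
    rw [payoffB_eq, payoffB_eq]
    exact h.trans (add_le_add_right h2 _)

end Solution

/-! ### Uniform bounds from bounded values -/

section Bounds

variable {w_lo w_hi : ℝ} (hlo : 0 < w_lo) (hhi : 0 < w_hi) (hG : G.ValuesBounded w_lo w_hi)
include hlo hhi hG

omit hlo hhi in
lemma div_le_vA (i : Fin n) : w_lo / w_hi / n ≤ G.vA i := by
  have hW : G.totalA ≤ n * w_hi := by
    simpa [totalA] using Finset.sum_le_sum fun i (_ : i ∈ Finset.univ) => (hG i).2.1
  rw [div_div, mul_comm w_hi]
  exact div_le_div₀ (G.wA_pos i).le (hG i).1 G.totalA_pos hW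

omit hlo hhi in
lemma div_le_vB (i : Fin n) : w_lo / w_hi / n ≤ G.vB i := by
  have hW : G.totalB ≤ n * w_hi := by
    simpa [totalB] using Finset.sum_le_sum fun i (_ : i ∈ Finset.univ) => (hG i).2.2.2
  rw [div_div, mul_comm w_hi]
  exact div_le_div₀ (G.wB_pos i).le (hG i).2.2.1 G.totalB_pos hW

lemma vA_le_div (i : Fin n) : G.vA i ≤ 1 / (w_lo / w_hi) / n := by
  have hn : (0 : ℝ) < n := by exact_mod_cast (by linarith [G.three_le] : 0 < n)
  have hW : n * w_lo ≤ G.totalA := by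
    simpa [totalA] using Finset.sum_le_sum fun i (_ : i ∈ Finset.univ) => (hG i).1
  rw [one_div_div, div_div, mul_comm w_lo]
  exact div_le_div₀ hhi.le (hG i).2.1 (by positivity) hW

lemma vB_le_div (i : Fin n) : G.vB i ≤ 1 / (w_lo / w_hi) / n := by
  have hn : (0 : ℝ) < n := by exact_mod_cast (by linarith [G.three_le] : 0 < n)
  have hW : n * w_lo ≤ G.totalB := by
    simpa [totalB] using Finset.sum_le_sum fun i (_ : i ∈ Finset.univ) => (hG i).2.2.1
  rw [one_div_div, div_div, mul_comm w_lo]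
  exact div_le_div₀ hhi.le (hG i).2.2.2 (by positivity) hW

omit hlo in
lemma ratio_le_one : w_lo / w_hi ≤ 1 := by
  obtain ⟨i⟩ := G.nonempty_fin
  exact (div_le_one hhi).2 ((hG i).1.trans (hG i).2.1)

/-- The condition `X_A ≤ X_B` excludes small `γ`: all battlefields would lie in `Ω_A`, and the
equation would read `X_B / X_A = γ * ∑ vB ^ 2 / vA`, whose right side is at most `γ / r ^ 3` with `r
= w_lo / w_hi`. -/
lemma ratio_pow_le_of_mem_solutions {γ : ℝ} (hγ : γ ∈ G.solutions) :
    (w_lo / w_hi) ^ 3 ≤ γ := by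
  have hn : (0 : ℝ) < n := by exact_mod_cast (by linarith [G.three_le] : 0 < n)
  have hvA := G.div_le_vA hG
  have hvB := G.vB_le_div hlo hhi hG
  have hr1 := G.ratio_le_one hhi hG
  have hr0 : 0 < w_lo / w_hi := div_pos hlo hhi
  set r := w_lo / w_hi
  -- Every ratio `vA / vB` is at least `(r / n) / (1 / (r * n)) = r ^ 2`.
  rcases lt_or_ge γ (r ^ 2) with h | h
  · have huniv : G.OmegaA γ = Finset.univ := by
      refine Finset.eq_univ_iff_forall.2 fun i => G.mem_OmegaA.2 (h.trans_le ?_)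
      rw [le_div_iff₀ (G.vB_pos i)]
      calc r ^ 2 * G.vB i ≤ r ^ 2 * (1 / r / n) := by gcongr; exact hvB i
        _ = r / n := by field_simp
        _ ≤ G.vA i := hvA i
    obtain ⟨h0, heq⟩ := hγ
    rw [huniv] at heq
    simp only [Finset.compl_univ, Finset.sum_empty, mul_zero, add_zero, G.sum_vB, div_one] at heq
    have hS : ∑ i, G.vB i ^ 2 / G.vA i ≤ 1 / r ^ 3 := by
      calc ∑ i, G.vB i ^ 2 / G.vA i ≤ ∑ _i : Fin n, (1 / r / n) ^ 2 / (r / n) := by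
            refine Finset.sum_le_sum fun i _ => ?_
            have := G.vB_pos i
            exact div_le_div₀ (by positivity) (pow_le_pow_left₀ this.le (hvB i) 2)
              (by positivity) (hvA i)
        _ = 1 / r ^ 3 := by
            simp only [Finset.sum_const, Finset.card_univ, Fintype.card_fin, nsmul_eq_mul]
            field_simp
    have h1 : X_B / X_A = γ * ∑ i, G.vB i ^ 2 / G.vA i := by
      refine mul_left_cancel₀ h0.ne' ?_
      linear_combination heq
    have h2 : 1 ≤ X_B / X_A := (one_le_div G.budgetA_pos).2 G.budget_le
    have h3 : 1 ≤ γ * (1 / r ^ 3) :=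
      h2.trans (h1.le.trans (mul_le_mul_of_nonneg_left hS h0.le))
    rwa [mul_one_div, one_le_div (by positivity)] at h3
  · exact (pow_le_pow_of_le_one hr0.le hr1 (by norm_num)).trans h

/-- Each of the `n` summands of `2 * X_B * λ_A` is at least `r ^ 9 / n`: on `Ω_A`, `γ ^ 2` gives `r
^ 6` and `vB ^ 2 / vA` gives `r ^ 3 / n`; elsewhere `vA ≥ r / n`. -/
lemma le_lambdaA {γ : ℝ} (hγ : γ ∈ G.solutions) :
    (w_lo / w_hi) ^ 9 / (2 * X_B) ≤ G.lambdaA γ := by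
  have hn : (0 : ℝ) < n := by exact_mod_cast (by linarith [G.three_le] : 0 < n)
  have hB := G.budgetB_pos
  have hg := G.ratio_pow_le_of_mem_solutions hlo hhi hG hγ
  have hvA := G.div_le_vA hG
  have hvB := G.div_le_vB hG
  have hvA' := G.vA_le_div hlo hhi hG
  have hr1 := G.ratio_le_one hhi hG
  have hr0 : 0 < w_lo / w_hi := div_pos hlo hhi
  set r := w_lo / w_hi
  rw [div_le_iff₀ (by positivity), mul_comm (G.lambdaA γ), two_mul_lambdaA]
  calc r ^ 9 = ∑ _i : Fin n, r ^ 9 / n := by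
        simp only [Finset.sum_const, Finset.card_univ, Fintype.card_fin, nsmul_eq_mul]
        field_simp
    _ ≤ _ := by
        refine Finset.sum_le_sum fun i _ => ?_
        split_ifs
        · calc r ^ 9 / n = (r ^ 3) ^ 2 * ((r / n) ^ 2 / (1 / r / n)) := by field_simp
            _ ≤ γ ^ 2 * (G.vB i ^ 2 / G.vA i) := by
              have := G.vB_pos i
              refine mul_le_mul (pow_le_pow_left₀ (by positivity) hg 2) ?_ (by positivity)
                (by positivity)
              exact div_le_div₀ (by positivity) (pow_le_pow_left₀ (by positivity) (hvB i) 2)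
                (G.vA_pos i) (hvA' i)
        · refine le_trans ?_ (hvA i)
          gcongr
          exact pow_le_of_le_one hr0.le hr1 (by norm_num)

lemma cap_le_div {γ : ℝ} (hγ : γ ∈ G.solutions) (i : Fin n) :
    G.cap γ i ≤ 2 * X_B / (w_lo / w_hi) ^ 10 / n := by
  have hn : (0 : ℝ) < n := by exact_mod_cast (by linarith [G.three_le] : 0 < n)
  have hB := G.budgetB_pos
  have hr0 : 0 < w_lo / w_hi := div_pos hlo hhi
  refine (G.cap_le hγ i).trans ?_
  refine (div_le_div₀ (by positivity) (G.vA_le_div hlo hhi hG i) (by positivity)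
    (G.le_lambdaA hlo hhi hG hγ)).trans (le_of_eq ?_)
  field_simp

end Bounds

end GCBGame

/-! ### Choice of the error and its rate -/

/-- The Hoeffding exponent for bids in `[0, K / n]` equals `2 * log n * (X / X_A) ^ 2`. Normalizing
`η` by the smaller budget `X_A` lets one `η` serve both players. -/
lemma exp_neg_le_inv_natCast {n : ℕ} {K X_A X : ℝ} (hn : 1 ≤ n) (hK : 0 < K) (hX : 0 < X_A)
    (hXX : X_A ≤ X) :
    Real.exp (-(2 * (K / X_A * √(Real.log n / n) * X) ^ 2 / (n * (K / n) ^ 2))) ≤ (n : ℝ)⁻¹ := by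
  have hn0 : (0 : ℝ) < n := by exact_mod_cast hn
  have hlog : 0 ≤ Real.log n := Real.log_natCast_nonneg n
  rw [← Real.log_le_log_iff (Real.exp_pos _) (by positivity), Real.log_exp, Real.log_inv,
    neg_le_neg_iff, mul_pow, mul_pow, Real.sq_sqrt (by positivity)]
  have h1 : 2 * ((K / X_A) ^ 2 * (Real.log n / n) * X ^ 2) / (n * (K / n) ^ 2) =
      2 * Real.log n * (X / X_A) ^ 2 := by
    field_simp
  have h2 : 1 ≤ (X / X_A) ^ 2 := one_le_pow₀ ((one_le_div hX).2 hXX)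
  rw [h1]
  nlinarith

lemma isSoftO_sqrt_log_div (C D : ℝ) (hC : 0 ≤ C) (hD : 0 ≤ D) :
    IsSoftO (fun n => C * √(Real.log n / n) + D / (n + 1))
      (fun n => (n : ℝ) ^ (-(1 / 2) : ℝ)) := by
  refine ⟨1, Asymptotics.IsBigO.of_bound (C + D) ?_⟩
  filter_upwards [eventually_ge_atTop 3] with n hn
  have hn3 : (3 : ℝ) ≤ n := by exact_mod_cast hn
  have hn0 : (0 : ℝ) < n := by linarith
  -- From `n = 3` on, `√(log n) ≤ log n`, and one logarithm absorbs both error terms.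
  have hlog : 1 ≤ Real.log n := by
    rw [Real.le_log_iff_exp_le hn0]
    linarith [Real.exp_one_lt_d9]
  have hs : 0 < √(n : ℝ) := Real.sqrt_pos.2 hn0
  have hpow : (n : ℝ) ^ (-(1 / 2) : ℝ) = (√n)⁻¹ := by
    rw [Real.rpow_neg hn0.le, Real.sqrt_eq_rpow]
  have h1 : √(Real.log n / n) ≤ (√n)⁻¹ * Real.log n := by
    rw [Real.sqrt_div (by linarith), div_eq_inv_mul]
    gcongr
    exact Real.sqrt_le_iff.2 ⟨by linarith, by nlinarith⟩
  have h2 : 1 / ((n : ℝ) + 1) ≤ (√n)⁻¹ * Real.log n := by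
    have h3 : √(n : ℝ) ≤ n + 1 := Real.sqrt_le_iff.2 ⟨by linarith, by nlinarith⟩
    calc 1 / ((n : ℝ) + 1) ≤ (√n)⁻¹ := by
          rw [one_div]
          exact inv_anti₀ hs h3
      _ ≤ (√n)⁻¹ * Real.log n := le_mul_of_one_le_right (by positivity) hlog
  rw [hpow, pow_one, Real.norm_of_nonneg (by positivity), Real.norm_of_nonneg (by positivity)]
  have e1 := mul_le_mul_of_nonneg_left h1 hC
  have e2 := mul_le_mul_of_nonneg_left h2 hD
  rw [mul_one_div] at e2
  linarith

theorem mainTheorem2 (X_A X_B w_lo w_hi : ℝ) (hA : 0 < X_A) (hAB : X_A ≤ X_B)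
    (hlo : 0 < w_lo) (hhi : 0 < w_hi) :
    ∃ ε : ℕ → ℝ, (∀ n, 0 < ε n) ∧ IsSoftO ε (fun n => (n : ℝ) ^ (-(1 / 2) : ℝ)) ∧
      ∀ (n : ℕ) (G : GCBGame n X_A X_B), G.ValuesBounded w_lo w_hi →
        ∀ γ ∈ G.solutions,
          G.IsApproxEquilibrium (ε n * max G.totalA G.totalB) (G.iuA γ) (G.iuB γ) := by
  have hB : 0 < X_B := hA.trans_le hAB
  set K : ℝ := 2 * X_B / (w_lo / w_hi) ^ 10 with hKdef
  have hK : 0 < K := by positivity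
  -- This is `2η + 3δ` with `δ = 4 / (n + 1)`: the factor `2` of Hoeffding times `1 / n ≤ 2 / (n +
  -- 1)`. The denominator `n + 1` keeps `ε` positive at `n = 0` and `n = 1`, where the square root
  -- vanishes.
  refine ⟨fun n => 2 * (K / X_A) * √(Real.log n / n) + 12 / (n + 1), fun n => by positivity,
    isSoftO_sqrt_log_div _ _ (by positivity) (by norm_num), fun n G hG γ hγ => ?_⟩
  have hn1 : 1 ≤ n := by linarith [G.three_le]
  have hn : (1 : ℝ) ≤ n := by exact_mod_cast hn1
  have hcap := G.cap_le_div hlo hhi hG hγ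
  rw [← hKdef] at hcap
  have hη : 0 ≤ K / X_A * √(Real.log n / n) := by positivity
  have hdA := pi_atomUniform_real_deviantSet_le hA (G.atomA_nonneg hγ) (G.atomA_le_one hγ)
    (G.cap_pos hγ) hη (by positivity) hcap (G.sum_atomA hγ)
  have hdB := pi_atomUniform_real_deviantSet_le hB (G.atomB_nonneg hγ) (G.atomB_le_one hγ)
    (G.cap_pos hγ) hη (by positivity) hcap (G.sum_atomB hγ)
  rw [← G.distA_eq] at hdA
  rw [← G.distB_eq] at hdB
  have hinv : (n : ℝ)⁻¹ ≤ 2 / (n + 1) := by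
    rw [inv_eq_one_div, div_le_div_iff₀ (by linarith) (by linarith)]
    linarith
  have hdA' := hdA.trans (mul_le_mul_of_nonneg_left
    ((exp_neg_le_inv_natCast hn1 hK hA le_rfl).trans hinv) zero_le_two)
  have hdB' := hdB.trans (mul_le_mul_of_nonneg_left
    ((exp_neg_le_inv_natCast hn1 hK hA hAB).trans hinv) zero_le_two)
  have h := G.isApproxEquilibrium_of_concentration hγ hη hdA' hdB'
  convert h using 2
  ring
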